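/- Let $(p_t)_{t\ge 0}$ be a weakly continuous convolution semigroup of probability measures on $\mathbb{R}^d$ (that is, $p_0=\delta_0$ and $p_{s+t}=p_s*p_t$ for $s,t\ge0$) with Lévy triplet $(A,b,\nu)$: $A$ is a symmetric nonnegative definite $d\times d$ matrix, $b\in\mathbb{R}^d$, $\nu$ is a measure on $\mathbb{R}^d$ with $\nu(\{0\})=0$ and $\int\min(1,|y|^2)\,\nu(dy)<\infty$, and for all $t\ge0$, $\xi\in\mathbb{R}^d$, $$\int e^{i\langle \xi,y\rangle}p_t(dy)=\exp\Big(t\Big[-\tfrac12\langle\xi,A\xi\rangle+i\langle b,\xi\rangle+\int_{\mathbb{R}^d}\big(e^{i\langle\xi,y\rangle}-1-i\langle\xi,y\rangle 1_{|y|\le1}\big)\nu(dy)\Big]\Big).$$ Let $L$ be the infinitesimal generator of the semigroup $P_tf(x)=\int_{\mathbb{R}^d}f(z+x)\,p_t(dz)$ on $(C_0(\mathbb{R}^d),\|\cdot\|_\infty)$, i.e. $Lf=\lim_{h\to0^+}(P_hf-f)/h$ in norm, with domain $D(L)$ consisting of all $f\in C_0(\mathbb{R}^d)$ for which this limit exists.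 Let $\phi\in C_c^\infty(\mathbb{R}\times\mathbb{R}^d)$ be real-valued. Then for every $u\in\mathbb{R}$ we have $\phi(u,\cdot)\in D(L)$, and $L\phi(u,\cdot)$ is given, with $f=\phi(u,\cdot)$, by $$Lf(x)=\frac12\sum_{j,k=1}^dA_{jk}\frac{\partial^2f}{\partial x_j\partial x_k}(x)+\sum_{j=1}^db_j\frac{\partial f}{\partial x_j}(x)+\int_{\mathbb{R}^d}\Big(f(x+y)-f(x)-\sum_{j=1}^dy_j\frac{\partial f}{\partial x_j}(x)1_{|y|\le1}\Big)\nu(dy),\qquad x\in\mathbb{R}^d.$$ Moreover, for all $s\in\mathbb{R}$ and $x\in\mathbb{R}^d$, $$\int_s^\infty\int_{\mathbb{R}^d}\big[\partial_u\phi(u,x+z)+L\phi(u,x+z)\big]\,p_{u-s}(dz)\,du=-\phi(s,x),$$ where $L$ acts on the spatial variable; the inner integrand is $p_{u-s}$-integrable for every $u>s$, and the inner integral is an integrable function of $u$ on $(s,\infty)$. -/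

import Mathlib

open MeasureTheory Filter Set
open scoped NNReal Topology ContDiff ZeroAtInfty

noncomputable section

/-- `ℝ^d` with its Euclidean norm and inner product. -/
abbrev Rd (d : ℕ) : Type := EuclideanSpace ℝ (Fin d)

/-- A (weakly continuous) convolution semigroup `(p_t)_{t ≥ 0}` of probability measures on `ℝ^d`. -/
structure IsConvolutionSemigroup {d : ℕ} (p : ℝ≥0 → ProbabilityMeasure (Rd d)) : Prop where
  zero : (p 0 : Measure (Rd d)) = Measure.dirac 0
  add : ∀ s t : ℝ≥0, (p (s + t) : Measure (Rd d)) =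
    Measure.conv (p s : Measure (Rd d)) (p t : Measure (Rd d))
  continuous : Continuous p

/-- `(A, b, ν)` is a Lévy triplet: `A` is symmetric and nonnegative definite, `b ∈ ℝ^d`, and
`ν` is a Lévy measure, i.e. `ν {0} = 0` and `∫ min (1, |y|²) ν(dy) < ∞`. -/
structure IsLevyTriplet {d : ℕ} (A : Matrix (Fin d) (Fin d) ℝ) (b : Rd d)
    (ν : Measure (Rd d)) : Prop where
  posSemidef : A.PosSemidef
  measure_zero : ν {0} = 0
  lintegral_lt_top : ∫⁻ y, ENNReal.ofReal (min 1 (‖y‖ ^ 2)) ∂ν < ⊤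

/-- The Lévy–Khintchine exponent
`ψ(ξ) = -½ ⟨ξ, Aξ⟩ + i ⟨b, ξ⟩ + ∫ (e^{i⟨y, ξ⟩} - 1 - i ⟨y, ξ⟩ 1_{|y| ≤ 1}) ν(dy)`. -/
def levyExponent {d : ℕ} (A : Matrix (Fin d) (Fin d) ℝ) (b : Rd d) (ν : Measure (Rd d))
    (ξ : Rd d) : ℂ :=
  -(1 / 2) * (((∑ j, ∑ k, A j k * ξ j * ξ k : ℝ)) : ℂ)
    + ((inner ℝ b ξ : ℝ) : ℂ) * Complex.I
    + ∫ y, (Complex.exp (((inner ℝ y ξ : ℝ) : ℂ) * Complex.I) - 1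
        - (((Metric.closedBall (0 : Rd d) 1).indicator (fun y => (inner ℝ y ξ : ℝ)) y : ℝ) : ℂ)
            * Complex.I) ∂ν

/-- The family `(p_t)` has generating triplet `(A, b, ν)`: the characteristic function of `p_t` is
`exp (t ψ)` for all `t ≥ 0`, where `ψ` is the Lévy–Khintchine exponent of `(A, b, ν)`. -/
def HasGeneratingTriplet {d : ℕ} (p : ℝ≥0 → ProbabilityMeasure (Rd d))
    (A : Matrix (Fin d) (Fin d) ℝ) (b : Rd d) (ν : Measure (Rd d)) : Prop :=
  IsLevyTriplet A b ν ∧ ∀ (t : ℝ≥0) (ξ : Rd d),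
    charFun (p t : Measure (Rd d)) ξ = Complex.exp (((t : ℝ) : ℂ) * levyExponent A b ν ξ)

/-- The partial derivative `∂f/∂x_j`. -/
def partialD {d : ℕ} (j : Fin d) (f : Rd d → ℝ) (x : Rd d) : ℝ :=
  fderiv ℝ f x (EuclideanSpace.single j 1)

/-- The Lévy-type integro-differential expression
`½ ∑ A_{jk} ∂_j∂_k f(x) + ∑ b_j ∂_j f(x)
  + ∫ (f(x+y) - f(x) - ∑ y_j ∂_j f(x) 1_{|y| ≤ 1}) ν(dy)`. -/
def levyOperator {d : ℕ} (A : Matrix (Fin d) (Fin d) ℝ) (b : Rd d) (ν : Measure (Rd d))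
    (f : Rd d → ℝ) (x : Rd d) : ℝ :=
  (1 / 2) * ∑ j, ∑ k, A j k * partialD j (partialD k f) x
    + ∑ j, b j * partialD j f x
    + ∫ y, (f (x + y) - f x
        - (Metric.closedBall (0 : Rd d) 1).indicator (fun y => ∑ j, y j * partialD j f x) y) ∂ν

/-- The infinitesimal generator of a family `(T_t)_{t ≥ 0}` of bounded operators on a Banach
space: the operator `f ↦ lim_{h → 0+} (T_h f - f) / h` (norm limit), whose domain consists of all
`f` for which the limit exists. -/
def infinitesimalGenerator {Y : Type*} [NormedAddCommGroup Y] [NormedSpace ℝ Y]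
    (T : ℝ≥0 → Y →L[ℝ] Y) : Y →ₗ.[ℝ] Y where
  domain :=
    { carrier := {f | ∃ g, Tendsto (fun h : ℝ≥0 => (h : ℝ)⁻¹ • (T h f - f)) (𝓝[>] 0) (𝓝 g)}
      zero_mem' := ⟨0, by simp⟩
      add_mem' := by
        rintro f₁ f₂ ⟨g₁, h₁⟩ ⟨g₂, h₂⟩
        refine ⟨g₁ + g₂, (h₁.add h₂).congr fun h => ?_⟩
        rw [map_add, ← smul_add]
        congr 1
        abel
      smul_mem' := by
        rintro c f ⟨g, hg⟩
        refine ⟨c • g, (hg.const_smul c).congr fun h => ?_⟩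
        rw [map_smul, ← smul_sub, smul_comm] }
  toFun :=
    { toFun := fun f => f.2.choose
      map_add' := fun f₁ f₂ => by
        refine tendsto_nhds_unique (f₁ + f₂).2.choose_spec
          ((f₁.2.choose_spec.add f₂.2.choose_spec).congr fun h => ?_)
        rw [Submodule.coe_add, map_add, ← smul_add]
        congr 1
        abel
      map_smul' := fun c f => by
        refine tendsto_nhds_unique (c • f).2.choose_spec
          ((f.2.choose_spec.const_smul c).congr fun h => ?_)
        rw [Submodule.coe_smul, map_smul, ← smul_sub, smul_comm] }

theorem integrable_translate {d : ℕ} (μ : ProbabilityMeasure (Rd d)) (f : C₀(Rd d, ℝ))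
    (x : Rd d) : Integrable (fun z => f (z + x)) (μ : Measure (Rd d)) :=
  Integrable.of_bound (by
    have : Continuous fun z => f (z + x) := f.continuous.comp (by fun_prop)
    exact this.aestronglyMeasurable) ‖f.toBCF‖
    (Eventually.of_forall fun z => f.toBCF.norm_coe_le_norm (z + x))

/-- The operator `f ↦ ∫ f(z + ·) μ(dz)` on `C_0(ℝ^d)`. -/
def translationAverage {d : ℕ} (μ : ProbabilityMeasure (Rd d)) : C₀(Rd d, ℝ) →L[ℝ] C₀(Rd d, ℝ) :=
  LinearMap.mkContinuous
    { toFun := fun f =>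
        { toFun := fun x => ∫ z, f (z + x) ∂(μ : Measure (Rd d))
          continuous_toFun := by
            refine continuous_of_dominated (bound := fun _ => ‖f.toBCF‖)
              (fun x => (integrable_translate μ f x).aestronglyMeasurable)
              (fun x => Eventually.of_forall fun z => f.toBCF.norm_coe_le_norm (z + x))
              (integrable_const _) (Eventually.of_forall fun z => ?_)
            exact f.continuous.comp (by fun_prop)
          zero_at_infty' := by
            have : (cocompact (Rd d)).IsCountablyGenerated := by
              rw [← Metric.cobounded_eq_cocompact, ← comap_norm_atTop]
              infer_instance
            have key := tendsto_integral_filter_of_dominated_convergence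
              (μ := (μ : Measure (Rd d))) (l := cocompact (Rd d))
              (F := fun x z => f (z + x)) (f := fun _ => (0 : ℝ)) (fun _ => ‖f.toBCF‖)
              (Eventually.of_forall fun x => (integrable_translate μ f x).aestronglyMeasurable)
              (Eventually.of_forall fun x =>
                Eventually.of_forall fun z => f.toBCF.norm_coe_le_norm (z + x))
              (integrable_const _)
              (Eventually.of_forall fun z =>
                (zero_at_infty f).comp (Homeomorph.addLeft z).isClosedEmbedding.tendsto_cocompact)
            simpa using key }
      map_add' := fun f g => by
        ext x
        exact integral_add (integrable_translate μ f x) (integrable_translate μ g x)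
      map_smul' := fun c f => by
        ext x
        exact integral_const_mul c _ } 1 fun f => by
    rw [one_mul, ← ZeroAtInftyContinuousMap.norm_toBCF_eq_norm (f := f),
      ← ZeroAtInftyContinuousMap.norm_toBCF_eq_norm]
    refine (BoundedContinuousFunction.norm_le (norm_nonneg _)).2 fun x => ?_
    have := norm_integral_le_of_norm_le_const (μ := (μ : Measure (Rd d))) (C := ‖f.toBCF‖)
      (f := fun z => f (z + x)) (Eventually.of_forall fun z => f.toBCF.norm_coe_le_norm (z + x))
    simpa using this

/-- The semigroup `P_t f(x) = ∫ f(z + x) p_t(dz)` on `C_0(ℝ^d)`. -/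
def transitionSemigroup {d : ℕ} (p : ℝ≥0 → ProbabilityMeasure (Rd d)) :
    ℝ≥0 → C₀(Rd d, ℝ) →L[ℝ] C₀(Rd d, ℝ) :=
  fun t => translationAverage (p t)

theorem transitionSemigroup_apply {d : ℕ} (p : ℝ≥0 → ProbabilityMeasure (Rd d)) (t : ℝ≥0)
    (f : C₀(Rd d, ℝ)) (x : Rd d) :
    transitionSemigroup p t f x = ∫ z, f (z + x) ∂(p t : Measure (Rd d)) := rfl

/-- The infinitesimal generator `L` on `C_0(ℝ^d)` of the semigroup `(P_t)` given by `(p_t)`. -/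
def levyGenerator {d : ℕ} (p : ℝ≥0 → ProbabilityMeasure (Rd d)) :
    C₀(Rd d, ℝ) →ₗ.[ℝ] C₀(Rd d, ℝ) :=
  infinitesimalGenerator (transitionSemigroup p)

/-- The slice `φ(u, ·)` of a continuous compactly supported function on `ℝ × ℝ^d`, as an element
of `C_0(ℝ^d)`. -/
def timeSlice {d : ℕ} (φ : ℝ × Rd d → ℝ) (hφ : Continuous φ) (hc : HasCompactSupport φ) (u : ℝ) :
    C₀(Rd d, ℝ) where
  toFun := fun x => φ (u, x)
  continuous_toFun := hφ.comp (by fun_prop)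
  zero_at_infty' :=
    (hc.comp_isClosedEmbedding (g := fun x : Rd d => (u, x))
      ⟨isEmbedding_prodMkRight u, by
        have : range (fun x : Rd d => (u, x)) = {u} ×ˢ univ := by
          ext ⟨a, c⟩
          simp [eq_comm]
        rw [this]
        exact isClosed_singleton.prod isClosed_univ⟩).is_zero_at_infty

end

/-!
# The generator of a Lévy semigroup on test functions and the space-time Dynkin identity

By Fourier inversion on the Euclidean space underlying `ℝ × ℝ^d`, the test function `φ` is a
superposition of space-time characters `exp (i(τu + ⟨x, ξ⟩))` with a rapidly decreasing weight `w`
(`exists_charIntegral_eq`). On such superpositions (`charIntegral`) every operator in question is a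
multiplier of the weight:

* averaging translates over `p_t` multiplies `w` by the characteristic function `exp (tψ(ξ))`
  (`integral_charIntegral_add`);
* the integro-differential expression `levyOperator` multiplies `w` by the exponent `ψ(ξ)`
  (`ofReal_levyOperator_eq_charIntegral`), the jump part by Fubini, which applies because Lévy
  measures are s-finite and `|e^{i⟨y,ξ⟩} - 1 - i⟨y,ξ⟩ 1_{|y| ≤ 1}| ≤ 2 min(1, |y|²) (1 + |ξ|²)`.

Since characteristic functions are bounded by `1`, `Re ψ ≤ 0`, hence `|exp (tψ) - 1| ≤ t |ψ|`, and
`ψ` grows at most quadratically. The difference quotients of the semigroup at a superposition with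
finite second moment therefore converge uniformly in `x`, by dominated convergence of the weights,
to the superposition with weight `w ψ`. This is `exists_levyGenerator_eq_levyOperator`.

For the integral identity, put `z = iτ + ψ(ξ)` and let `W` be `w` times the space-time characters
at `(s, x)`. The average of `φ(u, x + ·)` over `p_{u-s}` is `∫ W exp ((u - s) z)`, and the average
of `∂_u φ + Lφ` is `∫ W z exp ((u - s) z)`, its derivative in `u`. The former equals `φ(s, x)` at
`u = s` and vanishes for large `u`, so the fundamental theorem of calculus on `(s, ∞)`
(`integral_Ioi_integral_mul_exp`) gives the claim.
-/

/-! ### Exponentials with nonpositive real part -/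

theorem Complex.norm_exp_sub_one_le_of_re_nonpos {z : ℂ} (hz : z.re ≤ 0) :
    ‖Complex.exp z - 1‖ ≤ ‖z‖ := by
  have h := norm_image_sub_le_of_norm_deriv_le_segment_01'
    (f := fun t : ℝ => Complex.exp (t * z)) (f' := fun t : ℝ => Complex.exp (t * z) * z)
    (C := ‖z‖) (fun t _ => ?_) (fun t ht => ?_)
  · simpa using h
  · have h1 : HasDerivAt (fun t : ℝ => (t : ℂ) * z) (1 * z) t :=
      (Complex.ofRealCLM.hasDerivAt (x := t)).mul_const z
    simpa using h1.cexp.hasDerivWithinAt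
  · rw [norm_mul, Complex.norm_exp]
    refine mul_le_of_le_one_left (norm_nonneg _) (Real.exp_le_one_iff.2 ?_)
    rw [Complex.re_ofReal_mul]
    exact mul_nonpos_of_nonneg_of_nonpos ht.1 hz

theorem Complex.norm_exp_mul_I_sub_one_sub_le (a : ℝ) :
    ‖Complex.exp (a * Complex.I) - 1 - a * Complex.I‖ ≤ 2 * a ^ 2 := by
  have hn : ‖(a : ℂ) * Complex.I‖ = |a| := by simp
  rcases le_total |a| 1 with h | h
  · refine (Complex.norm_exp_sub_one_sub_id_le (hn.trans_le h)).trans ?_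
    rw [hn, sq_abs]
    nlinarith [sq_nonneg a]
  · have h1 : ‖Complex.exp (a * Complex.I) - 1‖ ≤ |a| :=
      hn ▸ Complex.norm_exp_sub_one_le_of_re_nonpos (by simp)
    refine (norm_sub_le _ _).trans ?_
    rw [hn, ← sq_abs a]
    nlinarith

/-- Differentiation under the integral sign for `t ↦ ∫ W e * exp (t * z e)`, as long as the
exponentials stay bounded by `1` for times in a neighbourhood `s` of `t`. -/
theorem hasDerivAt_integral_mul_exp {E : Type*} [MeasurableSpace E] {m : Measure E} {W z : E → ℂ}
    (hz : AEStronglyMeasurable z m) (hW : Integrable W m) (hWz : Integrable (fun e => W e * z e) m)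
    {t : ℝ} {s : Set ℝ} (hs : s ∈ 𝓝 t) (hre : ∀ r ∈ s, ∀ e, r * (z e).re ≤ 0) :
    HasDerivAt (fun r : ℝ => ∫ e, W e * Complex.exp (r * z e) ∂m)
      (∫ e, W e * z e * Complex.exp (t * z e) ∂m) t := by
  have hexp : ∀ r : ℝ, AEStronglyMeasurable (fun e => Complex.exp (r * z e)) m := fun r =>
    Complex.continuous_exp.comp_aestronglyMeasurable (hz.const_mul _)
  have hle : ∀ r ∈ s, ∀ e, ‖Complex.exp (r * z e)‖ ≤ 1 := fun r hr e => by
    rw [Complex.norm_exp, Complex.re_ofReal_mul]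
    exact Real.exp_le_one_iff.2 (hre r hr e)
  refine (hasDerivAt_integral_of_dominated_loc_of_deriv_le (bound := fun e => ‖W e * z e‖)
    (F' := fun r e => W e * z e * Complex.exp (r * z e)) hs
    (Eventually.of_forall fun r => hW.aestronglyMeasurable.mul (hexp r)) ?_
    (hWz.aestronglyMeasurable.mul (hexp t)) (Eventually.of_forall fun e r hr => ?_) hWz.norm
    (Eventually.of_forall fun e r _ => ?_)).2
  · refine hW.norm.mono' (hW.aestronglyMeasurable.mul (hexp t)) (Eventually.of_forall fun e => ?_)
    rw [Pi.mul_apply, norm_mul]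
    exact mul_le_of_le_one_right (norm_nonneg _) (hle t (mem_of_mem_nhds hs) e)
  · rw [norm_mul]
    exact mul_le_of_le_one_right (norm_nonneg _) (hle r hr e)
  · have h1 : HasDerivAt (fun r : ℝ => (r : ℂ) * z e) (1 * z e) r :=
      (Complex.ofRealCLM.hasDerivAt (x := r)).mul_const (z e)
    exact (h1.cexp.const_mul (W e)).congr_deriv (by ring)

/-! ### Superpositions of characters -/

/-- The superposition of characters `x ↦ ∫ w(e) exp (i⟨x, ξ(e)⟩) m(de)` with frequencies `ξ(e)`
and complex weights `w(e)`. -/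
noncomputable def charIntegral {E : Type*} [MeasurableSpace E] {d : ℕ} (m : Measure E)
    (ξ : E → Rd d) (w : E → ℂ) (x : Rd d) : ℂ :=
  ∫ e, w e * Complex.exp ((inner ℝ x (ξ e) : ℝ) * Complex.I) ∂m

/-- The weight `w` has a finite second moment with respect to the frequencies `ξ`. -/
structure HasSecondMoment {E : Type*} [MeasurableSpace E] {d : ℕ} (m : Measure E)
    (ξ : E → Rd d) (w : E → ℂ) : Prop where
  measurable_freq : Measurable ξ
  aestronglyMeasurable : AEStronglyMeasurable w m
  integrable_norm : Integrable (fun e => (1 + ‖ξ e‖ ^ 2) * ‖w e‖) m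

section

variable {E : Type*} [MeasurableSpace E] {d : ℕ} {m : Measure E} {ξ : E → Rd d} {w : E → ℂ}

theorem HasSecondMoment.integrable_mul (h : HasSecondMoment m ξ w) {k : E → ℂ}
    (hk : AEStronglyMeasurable k m) (C : ℝ) (hC : ∀ e, ‖k e‖ ≤ C * (1 + ‖ξ e‖ ^ 2)) :
    Integrable (fun e => w e * k e) m := by
  refine (h.integrable_norm.const_mul C).mono' (h.aestronglyMeasurable.mul hk)
    (Eventually.of_forall fun e => ?_)
  rw [norm_mul, mul_comm, ← mul_assoc]
  exact mul_le_mul_of_nonneg_right (hC e) (norm_nonneg _)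

theorem HasSecondMoment.integrable (h : HasSecondMoment m ξ w) : Integrable w m := by
  simpa using h.integrable_mul (k := fun _ => 1) aestronglyMeasurable_const 1
    (fun e => by simp)

/-- Weights of modulus one preserve the second moment. -/
theorem HasSecondMoment.mul_of_norm_eq_one (h : HasSecondMoment m ξ w) {k : E → ℂ}
    (hk : AEStronglyMeasurable k m) (hk1 : ∀ e, ‖k e‖ = 1) :
    HasSecondMoment m ξ (fun e => w e * k e) where
  measurable_freq := h.measurable_freq
  aestronglyMeasurable := h.aestronglyMeasurable.mul hk
  integrable_norm := by simpa [hk1] using h.integrable_norm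

theorem measurable_character (hξ : Measurable ξ) (x : Rd d) :
    Measurable fun e => Complex.exp ((inner ℝ x (ξ e) : ℝ) * Complex.I) := by
  fun_prop

theorem integrable_mul_character (hξ : Measurable ξ) (hw : Integrable w m) (x : Rd d) :
    Integrable (fun e => w e * Complex.exp ((inner ℝ x (ξ e) : ℝ) * Complex.I)) m := by
  refine hw.norm.mono' (hw.aestronglyMeasurable.mul
    (measurable_character hξ x).aestronglyMeasurable) (Eventually.of_forall fun e => ?_)
  rw [norm_mul, Complex.norm_exp_ofReal_mul_I, mul_one]

theorem norm_charIntegral_le (x : Rd d) : ‖charIntegral m ξ w x‖ ≤ ∫ e, ‖w e‖ ∂m := by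
  refine (norm_integral_le_integral_norm _).trans_eq ?_
  simp only [norm_mul, Complex.norm_exp_ofReal_mul_I, mul_one]

theorem continuous_charIntegral (hξ : Measurable ξ) (hw : Integrable w m) :
    Continuous (charIntegral m ξ w) := by
  refine continuous_of_dominated (bound := fun e => ‖w e‖)
    (fun x => (integrable_mul_character hξ hw x).aestronglyMeasurable)
    (fun x => Eventually.of_forall fun e => ?_) hw.norm
    (Eventually.of_forall fun e => by fun_prop)
  rw [norm_mul, Complex.norm_exp_ofReal_mul_I, mul_one]

/-- Averaging the translates of a superposition of characters against a probability measure
multiplies the weight by the characteristic function. -/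
theorem integral_charIntegral_add [SFinite m] (hξ : Measurable ξ) (hw : Integrable w m)
    (μ : Measure (Rd d)) [IsProbabilityMeasure μ] (x : Rd d) :
    ∫ z, charIntegral m ξ w (z + x) ∂μ = charIntegral m ξ (fun e => w e * charFun μ (ξ e)) x := by
  unfold charIntegral
  rw [integral_integral_swap]
  · congr 1 with e
    simp only [charFun_apply, inner_add_left, Complex.ofReal_add, add_mul, Complex.exp_add]
    rw [integral_const_mul, integral_mul_const]
    ring
  · refine (hw.comp_snd μ).norm.mono' ?_ (Eventually.of_forall fun q => ?_)
    · refine (hw.aestronglyMeasurable.comp_snd).mul (Measurable.aestronglyMeasurable ?_)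
      fun_prop
    · rw [Function.uncurry, norm_mul, Complex.norm_exp_ofReal_mul_I, mul_one]

/-- The derivative of a superposition of characters in the direction `v` multiplies the weight by
`i⟨v, ξ⟩`. -/
theorem ofReal_fderiv_eq_charIntegral {f : Rd d → ℝ} (hf : Differentiable ℝ f)
    (hfw : ∀ x, (f x : ℂ) = charIntegral m ξ w x) (hξ : Measurable ξ) (hw : Integrable w m)
    (v : Rd d) (hwv : Integrable (fun e => w e * ((inner ℝ v (ξ e) : ℝ) * Complex.I)) m)
    (x : Rd d) :
    (fderiv ℝ f x v : ℂ) =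
      charIntegral m ξ (fun e => w e * ((inner ℝ v (ξ e) : ℝ) * Complex.I)) x := by
  have hlin : HasDerivAt (fun r : ℝ => x + r • v) v 0 := by
    simpa using ((hasDerivAt_id (0 : ℝ)).smul_const v).const_add x
  have h1 : HasDerivAt (fun r : ℝ => (f (x + r • v) : ℂ)) (fderiv ℝ f x v : ℂ) 0 := by
    have hfx : HasFDerivAt f (fderiv ℝ f x) (x + (0 : ℝ) • v) := by
      simpa using (hf x).hasFDerivAt
    exact (hfx.comp_hasDerivAt (0 : ℝ) hlin).ofReal_comp
  have hξv : Measurable fun e => ((inner ℝ v (ξ e) : ℝ) : ℂ) * Complex.I := by fun_prop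
  have h2 := hasDerivAt_integral_mul_exp (m := m)
    (W := fun e => w e * Complex.exp ((inner ℝ x (ξ e) : ℝ) * Complex.I))
    (z := fun e => (inner ℝ v (ξ e) : ℝ) * Complex.I) (t := 0) hξv.aestronglyMeasurable
    (integrable_mul_character hξ hw x)
    ((integrable_mul_character hξ hwv x).congr (Eventually.of_forall fun e => by ring))
    univ_mem (fun r _ e => by simp)
  refine h1.unique (h2.congr_deriv ?_ |>.congr_of_eventuallyEq (Eventually.of_forall fun r => ?_))
  · unfold charIntegral
    congr 1 with e
    simp
    ring
  · simp only
    rw [hfw]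
    unfold charIntegral
    congr 1 with e
    rw [inner_add_left, inner_smul_left, mul_assoc, ← Complex.exp_add]
    congr 2
    simp
    ring

theorem sum_mul_partialD_eq_fderiv (f : Rd d → ℝ) (x v : Rd d) :
    ∑ j, v j * partialD j f x = fderiv ℝ f x v := by
  have hv : ∑ j, v j • EuclideanSpace.single j (1 : ℝ) = v := by
    simpa using (EuclideanSpace.basisFun (Fin d) ℝ).sum_repr v
  conv_rhs => rw [← hv, map_sum]
  simp [partialD]

end

/-! ### Lévy measures and the Lévy–Khintchine exponent -/

/-- The integrand `e^{i⟨y, ξ⟩} - 1 - i⟨y, ξ⟩ 1_{|y| ≤ 1}` of the Lévy–Khintchine formula. -/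
noncomputable def levyKernel {d : ℕ} (y ξ : Rd d) : ℂ :=
  Complex.exp (((inner ℝ y ξ : ℝ) : ℂ) * Complex.I) - 1
    - (((Metric.closedBall (0 : Rd d) 1).indicator (fun y => (inner ℝ y ξ : ℝ)) y : ℝ) : ℂ)
      * Complex.I

section

variable {d : ℕ} {A : Matrix (Fin d) (Fin d) ℝ} {b : Rd d} {ν : Measure (Rd d)}

theorem measurable_levyKernel : Measurable fun q : Rd d × Rd d => levyKernel q.1 q.2 := by
  unfold levyKernel
  have : Measurable fun q : Rd d × Rd d =>
      (Metric.closedBall (0 : Rd d) 1).indicator (fun y => (inner ℝ y q.2 : ℝ)) q.1 := by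
    have h : (fun q : Rd d × Rd d =>
        (Metric.closedBall (0 : Rd d) 1).indicator (fun y => (inner ℝ y q.2 : ℝ)) q.1)
        = (Metric.closedBall (0 : Rd d) 1 ×ˢ univ).indicator fun q => inner ℝ q.1 q.2 := by
      ext q
      by_cases hq : q.1 ∈ Metric.closedBall (0 : Rd d) 1 <;> simp [indicator, hq]
    rw [h]
    exact Measurable.indicator (by fun_prop)
      (Metric.isClosed_closedBall.measurableSet.prod MeasurableSet.univ)
  fun_prop

theorem Measurable.levyKernel {α : Type*} [MeasurableSpace α] {g k : α → Rd d}
    (hg : Measurable g) (hk : Measurable k) : Measurable fun a => levyKernel (g a) (k a) := by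
  have h := measurable_levyKernel.comp (hg.prodMk hk)
  exact h

theorem norm_levyKernel_le (y ξ : Rd d) :
    ‖levyKernel y ξ‖ ≤ 2 * min 1 (‖y‖ ^ 2) * (1 + ‖ξ‖ ^ 2) := by
  unfold levyKernel
  by_cases hy : ‖y‖ ≤ 1
  · rw [indicator_of_mem (by simpa using hy), min_eq_right (pow_le_one₀ (norm_nonneg _) hy)]
    refine (Complex.norm_exp_mul_I_sub_one_sub_le _).trans ?_
    have h := pow_le_pow_left₀ (abs_nonneg _) (abs_real_inner_le_norm y ξ) 2
    rw [sq_abs, mul_pow] at h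
    nlinarith [sq_nonneg ‖y‖]
  · rw [indicator_of_notMem (by simpa using hy), min_eq_left (one_le_pow₀ (not_le.1 hy).le)]
    have h := norm_sub_le (Complex.exp (((inner ℝ y ξ : ℝ) : ℂ) * Complex.I)) 1
    rw [Complex.norm_exp_ofReal_mul_I, norm_one] at h
    simp only [Complex.ofReal_zero, zero_mul, sub_zero]
    nlinarith [sq_nonneg ‖ξ‖]

theorem IsLevyTriplet.integrable_min (h : IsLevyTriplet A b ν) :
    Integrable (fun y : Rd d => min 1 (‖y‖ ^ 2)) ν := by
  refine ⟨(by fun_prop : Measurable fun y : Rd d => min 1 (‖y‖ ^ 2)).aestronglyMeasurable, ?_⟩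
  rw [hasFiniteIntegral_iff_ofReal (Eventually.of_forall fun y => by positivity)]
  exact h.lintegral_lt_top

/-- A Lévy measure is s-finite: away from the null set `{0}` it has a density with respect to the
finite measure `min (1, |y|²) ν(dy)`. -/
theorem IsLevyTriplet.sFinite (h : IsLevyTriplet A b ν) : SFinite ν := by
  have hfin : IsFiniteMeasure (ν.withDensity fun y => ENNReal.ofReal (min 1 (‖y‖ ^ 2))) :=
    isFiniteMeasure_withDensity h.lintegral_lt_top.ne
  rw [← withDensity_inv_same (μ := ν) (f := fun y => ENNReal.ofReal (min 1 (‖y‖ ^ 2)))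
    (by fun_prop) ?_ (Eventually.of_forall fun y => ENNReal.ofReal_ne_top)]
  · infer_instance
  · have h0 : ∀ᵐ y ∂ν, y ≠ 0 := by
      rw [ae_iff]
      simpa using h.measure_zero
    filter_upwards [h0] with y hy
    have : 0 < ‖y‖ := norm_pos_iff.2 hy
    simp only [ne_eq, ENNReal.ofReal_eq_zero, not_le]
    positivity

theorem IsLevyTriplet.measurable_levyExponent (h : IsLevyTriplet A b ν) :
    Measurable (levyExponent A b ν) := by
  have := h.sFinite
  have hK : Measurable fun ξ : Rd d => ∫ y, levyKernel y ξ ∂ν :=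
    (StronglyMeasurable.integral_prod_right (f := fun ξ y => levyKernel y ξ)
      (measurable_levyKernel.comp measurable_swap).stronglyMeasurable).measurable
  unfold levyExponent
  refine Measurable.add (by fun_prop) hK

/-- The Lévy–Khintchine exponent grows at most quadratically. -/
theorem IsLevyTriplet.exists_norm_le (h : IsLevyTriplet A b ν) :
    ∃ C : ℝ, ∀ ξ : Rd d, ‖levyExponent A b ν ξ‖ ≤ C * (1 + ‖ξ‖ ^ 2) := by
  refine ⟨(∑ j, ∑ k, |A j k|) + ‖b‖ + ∫ y, 2 * min 1 (‖y‖ ^ 2) ∂ν, fun ξ => ?_⟩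
  have hjump : ‖∫ y, levyKernel y ξ ∂ν‖ ≤ (∫ y, 2 * min 1 (‖y‖ ^ 2) ∂ν) * (1 + ‖ξ‖ ^ 2) := by
    rw [← integral_mul_const]
    exact norm_integral_le_of_norm_le ((h.integrable_min.const_mul 2).mul_const _)
      (Eventually.of_forall fun y => norm_levyKernel_le y ξ)
  have hcoord : ∀ j, |ξ j| ≤ ‖ξ‖ := fun j => by
    simpa using PiLp.norm_apply_le ξ j
  have hquad : |∑ j, ∑ k, A j k * ξ j * ξ k| ≤ (∑ j, ∑ k, |A j k|) * ‖ξ‖ ^ 2 := by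
    rw [Finset.sum_mul]
    refine (Finset.abs_sum_le_sum_abs _ _).trans (Finset.sum_le_sum fun j _ => ?_)
    rw [Finset.sum_mul]
    refine (Finset.abs_sum_le_sum_abs _ _).trans (Finset.sum_le_sum fun k _ => ?_)
    rw [abs_mul, abs_mul, mul_assoc, sq]
    gcongr
    · exact hcoord j
    · exact hcoord k
  have hdrift : |inner ℝ b ξ| ≤ ‖b‖ * ‖ξ‖ := abs_real_inner_le_norm b ξ
  have hA : 0 ≤ ∑ j, ∑ k, |A j k| :=
    Finset.sum_nonneg fun j _ => Finset.sum_nonneg fun k _ => abs_nonneg _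
  refine (norm_add_le _ _).trans ((add_le_add (norm_add_le _ _) hjump).trans ?_)
  rw [norm_mul, norm_mul, Complex.norm_I, Complex.norm_real, Complex.norm_real, Real.norm_eq_abs,
    Real.norm_eq_abs]
  norm_num
  nlinarith [norm_nonneg b, norm_nonneg ξ, sq_nonneg (‖ξ‖ - 1), sq_nonneg ‖ξ‖,
    mul_nonneg (norm_nonneg b) (sq_nonneg (‖ξ‖ - 1)), mul_nonneg hA (sq_nonneg ‖ξ‖),
    mul_nonneg (norm_nonneg b) (sq_nonneg ‖ξ‖)]

/-- The exponent has nonpositive real part since characteristic functions are bounded by `1`. -/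
theorem HasGeneratingTriplet.re_levyExponent_nonpos {p : ℝ≥0 → ProbabilityMeasure (Rd d)}
    (h : HasGeneratingTriplet p A b ν) (ξ : Rd d) : (levyExponent A b ν ξ).re ≤ 0 := by
  have h1 := norm_charFun_le_one (μ := (p 1 : Measure (Rd d))) ξ
  rw [h.2 1 ξ, Complex.norm_exp, Real.exp_le_one_iff] at h1
  simpa using h1

end

/-! ### The Lévy operator as a Fourier multiplier -/

section

variable {E : Type*} [MeasurableSpace E] {d : ℕ} {m : Measure E} {ξ : E → Rd d} {w : E → ℂ}
  {A : Matrix (Fin d) (Fin d) ℝ} {b : Rd d} {ν : Measure (Rd d)} {f : Rd d → ℝ}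

theorem HasSecondMoment.integrable_mul_inner (h : HasSecondMoment m ξ w) (v : Rd d) :
    Integrable (fun e => w e * ((inner ℝ v (ξ e) : ℝ) * Complex.I)) m := by
  have hξ := h.measurable_freq
  refine h.integrable_mul (by fun_prop : Measurable fun e =>
    ((inner ℝ v (ξ e) : ℝ) : ℂ) * Complex.I).aestronglyMeasurable ‖v‖ fun e => ?_
  rw [norm_mul, Complex.norm_I, mul_one, Complex.norm_real]
  refine (norm_inner_le_norm v (ξ e)).trans ?_
  gcongr
  nlinarith [sq_nonneg (‖ξ e‖ - 1)]

theorem HasSecondMoment.integrable_mul_inner_mul_inner (h : HasSecondMoment m ξ w) (v v' : Rd d) :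
    Integrable (fun e => w e * ((inner ℝ v (ξ e) : ℝ) * Complex.I)
      * ((inner ℝ v' (ξ e) : ℝ) * Complex.I)) m := by
  have hξ := h.measurable_freq
  simp_rw [mul_assoc]
  refine h.integrable_mul (k := fun e => ((inner ℝ v (ξ e) : ℝ) : ℂ) * (Complex.I *
    (((inner ℝ v' (ξ e) : ℝ) : ℂ) * Complex.I)))
    (by fun_prop : Measurable _).aestronglyMeasurable (‖v‖ * ‖v'‖) fun e => ?_
  simp only [norm_mul, Complex.norm_I, mul_one, one_mul, Complex.norm_real]
  calc ‖inner ℝ v (ξ e)‖ * ‖inner ℝ v' (ξ e)‖ ≤ (‖v‖ * ‖ξ e‖) * (‖v'‖ * ‖ξ e‖) := by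
        gcongr <;> exact norm_inner_le_norm _ _
    _ = ‖v‖ * ‖v'‖ * ‖ξ e‖ ^ 2 := by ring
    _ ≤ _ := by gcongr; linarith

theorem HasSecondMoment.integrable_mul_levyExponent (h : HasSecondMoment m ξ w)
    (hL : IsLevyTriplet A b ν) : Integrable (fun e => w e * levyExponent A b ν (ξ e)) m := by
  obtain ⟨C, hC⟩ := hL.exists_norm_le
  exact h.integrable_mul (hL.measurable_levyExponent.comp h.measurable_freq).aestronglyMeasurable C
    fun e => hC _

theorem HasSecondMoment.integrable_mul_levyKernel [SFinite m] (h : HasSecondMoment m ξ w)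
    (hL : IsLevyTriplet A b ν) :
    Integrable (fun q : Rd d × E => w q.2 * levyKernel q.1 (ξ q.2)) (ν.prod m) := by
  have := hL.sFinite
  have hbound : Integrable (fun q : Rd d × E =>
      (2 * min 1 (‖q.1‖ ^ 2)) * ((1 + ‖ξ q.2‖ ^ 2) * ‖w q.2‖)) (ν.prod m) :=
    Integrable.mul_prod (f := fun y : Rd d => 2 * min 1 (‖y‖ ^ 2))
      (hL.integrable_min.const_mul 2) h.integrable_norm
  have hK : Measurable fun q : Rd d × E => levyKernel q.1 (ξ q.2) :=
    measurable_fst.levyKernel (h.measurable_freq.comp measurable_snd)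
  have hw : AEStronglyMeasurable (fun q : Rd d × E => w q.2) (ν.prod m) :=
    h.aestronglyMeasurable.comp_snd
  have hm : AEStronglyMeasurable (fun q : Rd d × E => w q.2 * levyKernel q.1 (ξ q.2))
      (ν.prod m) := hw.mul hK.aestronglyMeasurable
  have hle : ∀ q : Rd d × E, ‖w q.2 * levyKernel q.1 (ξ q.2)‖
      ≤ (2 * min 1 (‖q.1‖ ^ 2)) * ((1 + ‖ξ q.2‖ ^ 2) * ‖w q.2‖) := fun q => by
    rw [norm_mul, mul_comm, ← mul_assoc]
    exact mul_le_mul_of_nonneg_right (norm_levyKernel_le _ _) (norm_nonneg _)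
  exact hbound.mono' hm (Eventually.of_forall hle)

/-- The compensated difference of a superposition of characters multiplies the weight by the
Lévy kernel. -/
theorem ofReal_compensated_sub_eq_charIntegral (h : HasSecondMoment m ξ w)
    (hf : Differentiable ℝ f) (hfw : ∀ x, (f x : ℂ) = charIntegral m ξ w x) (x y : Rd d) :
    ((f (x + y) - f x - (Metric.closedBall (0 : Rd d) 1).indicator
        (fun y => ∑ j, y j * partialD j f x) y : ℝ) : ℂ)
      = charIntegral m ξ (fun e => w e * levyKernel y (ξ e)) x := by
  have hξ := h.measurable_freq
  have hw := h.integrable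
  have hadd : (f (x + y) : ℂ)
      = ∫ e, w e * Complex.exp ((inner ℝ x (ξ e) : ℝ) * Complex.I)
          * Complex.exp ((inner ℝ y (ξ e) : ℝ) * Complex.I) ∂m := by
    rw [hfw]
    unfold charIntegral
    simp only [inner_add_left, Complex.ofReal_add, add_mul, Complex.exp_add, mul_assoc]
  have hi1 := integrable_mul_character hξ (integrable_mul_character hξ hw x) y
  have hi2 := integrable_mul_character hξ hw x
  rw [Complex.ofReal_sub, Complex.ofReal_sub, hadd, hfw x]
  simp only [charIntegral, levyKernel]
  by_cases hy : y ∈ Metric.closedBall (0 : Rd d) 1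
  · rw [indicator_of_mem hy, sum_mul_partialD_eq_fderiv,
      ofReal_fderiv_eq_charIntegral hf hfw hξ hw y (h.integrable_mul_inner y)]
    simp only [charIntegral]
    have hi12 : Integrable (fun e => w e * Complex.exp ((inner ℝ x (ξ e) : ℝ) * Complex.I)
        * Complex.exp ((inner ℝ y (ξ e) : ℝ) * Complex.I)
        - w e * Complex.exp ((inner ℝ x (ξ e) : ℝ) * Complex.I)) m := hi1.sub hi2
    rw [← integral_sub hi1 hi2, ← integral_sub hi12
      (integrable_mul_character hξ (h.integrable_mul_inner y) x)]
    congr 1 with e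
    rw [indicator_of_mem hy]
    ring
  · rw [indicator_of_notMem hy, Complex.ofReal_zero, sub_zero, ← integral_sub hi1 hi2]
    congr 1 with e
    rw [indicator_of_notMem hy]
    simp only [Complex.ofReal_zero]
    ring

/-- On superpositions of characters the Lévy operator acts by multiplying the weight by the
Lévy–Khintchine exponent. -/
theorem ofReal_levyOperator_eq_charIntegral [SFinite m] (h : HasSecondMoment m ξ w)
    (hL : IsLevyTriplet A b ν) (hf : ContDiff ℝ 2 f)
    (hfw : ∀ x, (f x : ℂ) = charIntegral m ξ w x) (x : Rd d) :
    (levyOperator A b ν f x : ℂ)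
      = charIntegral m ξ (fun e => w e * levyExponent A b ν (ξ e)) x := by
  have := hL.sFinite
  have hξ := h.measurable_freq
  have hw := h.integrable
  have hfd : Differentiable ℝ f := hf.differentiable (by norm_num)
  have hcoord : ∀ (j : Fin d) (e : E),
      inner ℝ (EuclideanSpace.single j (1 : ℝ)) (ξ e) = ξ e j := fun j e => by
    simp [EuclideanSpace.inner_single_left]
  have hdiffusion : ∀ j k, ((A j k * partialD j (partialD k f) x : ℝ) : ℂ)
      = ∫ e, w e * Complex.exp ((inner ℝ x (ξ e) : ℝ) * Complex.I)
          * -((A j k * ξ e j * ξ e k : ℝ) : ℂ) ∂m := fun j k => by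
    have hdk : Differentiable ℝ (partialD k f) :=
      ((hf.fderiv_right (m := 1) (by norm_num)).clm_apply contDiff_const).differentiable
        (by norm_num)
    have h1 := ofReal_fderiv_eq_charIntegral hfd hfw hξ hw (EuclideanSpace.single k 1)
      (h.integrable_mul_inner _)
    have h2 := ofReal_fderiv_eq_charIntegral hdk h1 hξ (h.integrable_mul_inner _)
      (EuclideanSpace.single j 1) (h.integrable_mul_inner_mul_inner _ _) x
    rw [Complex.ofReal_mul]
    refine (congrArg _ h2).trans ?_
    unfold charIntegral
    rw [← integral_const_mul]
    congr 1 with e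
    simp only [hcoord, Complex.ofReal_mul]
    linear_combination (A j k * w e * ξ e j * ξ e k *
      Complex.exp ((inner ℝ x (ξ e) : ℝ) * Complex.I)) * Complex.I_mul_I
  have hquadint : ∀ j k, Integrable (fun e => w e
      * Complex.exp ((inner ℝ x (ξ e) : ℝ) * Complex.I) * -((A j k * ξ e j * ξ e k : ℝ) : ℂ)) m :=
    fun j k => by
    refine ((integrable_mul_character hξ (h.integrable_mul_inner_mul_inner
      (EuclideanSpace.single j 1) (EuclideanSpace.single k 1)) x).const_mul (A j k : ℂ)).congr
      (Eventually.of_forall fun e => ?_)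
    simp only [hcoord, Complex.ofReal_mul]
    linear_combination (A j k * w e * ξ e j * ξ e k *
      Complex.exp ((inner ℝ x (ξ e) : ℝ) * Complex.I)) * Complex.I_mul_I
  have hdiffint : Integrable (fun e => (1 / 2 : ℂ) * ∑ j, ∑ k, w e
      * Complex.exp ((inner ℝ x (ξ e) : ℝ) * Complex.I) * -((A j k * ξ e j * ξ e k : ℝ) : ℂ)) m :=
    (integrable_finsetSum _ fun j _ => integrable_finsetSum _ fun k _ =>
      hquadint j k).const_mul _
  have hdrift : ((∑ j, b j * partialD j f x : ℝ) : ℂ) = charIntegral m ξ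
      (fun e => w e * ((inner ℝ b (ξ e) : ℝ) * Complex.I)) x := by
    rw [sum_mul_partialD_eq_fderiv,
      ofReal_fderiv_eq_charIntegral hfd hfw hξ hw b (h.integrable_mul_inner b)]
  have hdriftint := integrable_mul_character hξ (h.integrable_mul_inner b) x
  have hkernel : Integrable (fun q : Rd d × E => w q.2 * levyKernel q.1 (ξ q.2)
      * Complex.exp ((inner ℝ x (ξ q.2) : ℝ) * Complex.I)) (ν.prod m) :=
    integrable_mul_character (ξ := fun q : Rd d × E => ξ q.2) (hξ.comp measurable_snd)
      (h.integrable_mul_levyKernel hL) x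
  have hjump : ((∫ y, (f (x + y) - f x - (Metric.closedBall (0 : Rd d) 1).indicator
        (fun y => ∑ j, y j * partialD j f x) y) ∂ν : ℝ) : ℂ)
      = ∫ e, ∫ y, w e * levyKernel y (ξ e)
          * Complex.exp ((inner ℝ x (ξ e) : ℝ) * Complex.I) ∂ν ∂m := by
    rw [← integral_complex_ofReal]
    simp_rw [ofReal_compensated_sub_eq_charIntegral h hfd hfw x]
    exact integral_integral_swap hkernel
  have hjumpint : Integrable (fun e => ∫ y, w e * levyKernel y (ξ e)
      * Complex.exp ((inner ℝ x (ξ e) : ℝ) * Complex.I) ∂ν) m := hkernel.swap.integral_prod_left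
  have hsplit : charIntegral m ξ (fun e => w e * levyExponent A b ν (ξ e)) x
      = ∫ e, ((1 / 2 : ℂ) * (∑ j, ∑ k, w e * Complex.exp ((inner ℝ x (ξ e) : ℝ) * Complex.I)
            * -((A j k * ξ e j * ξ e k : ℝ) : ℂ))
          + w e * ((inner ℝ b (ξ e) : ℝ) * Complex.I)
            * Complex.exp ((inner ℝ x (ξ e) : ℝ) * Complex.I)
          + ∫ y, w e * levyKernel y (ξ e)
            * Complex.exp ((inner ℝ x (ξ e) : ℝ) * Complex.I) ∂ν) ∂m := by
    simp only [charIntegral]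
    congr 1 with e
    have hψ : levyExponent A b ν (ξ e)
        = -(1 / 2) * (((∑ j, ∑ k, A j k * ξ e j * ξ e k : ℝ)) : ℂ)
          + ((inner ℝ b (ξ e) : ℝ) : ℂ) * Complex.I + ∫ y, levyKernel y (ξ e) ∂ν := rfl
    rw [integral_mul_const, integral_const_mul, hψ]
    simp only [← Finset.mul_sum, Finset.sum_neg_distrib, Complex.ofReal_sum]
    ring
  unfold levyOperator
  rw [hsplit, integral_add (f := fun e => _ + _) (hdiffint.add hdriftint) hjumpint,
    integral_add hdiffint hdriftint,
    integral_const_mul, integral_finsetSum _ fun j _ =>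
      integrable_finsetSum _ fun k _ => hquadint j k]
  simp_rw [integral_finsetSum _ fun k _ => hquadint _ k, ← hdiffusion]
  rw [Complex.ofReal_add, Complex.ofReal_add, hdrift, hjump]
  simp [charIntegral]

end

/-! ### The generator on superpositions of characters -/

theorem ZeroAtInftyContinuousMap.exists_tendsto_of_tendstoUniformly {X ι : Type*}
    [TopologicalSpace X] {l : Filter ι} [l.NeBot] {F : ι → C₀(X, ℝ)} {g : X → ℝ}
    (h : TendstoUniformly (fun i => ⇑(F i)) g l) :
    ∃ G : C₀(X, ℝ), ⇑G = g ∧ Tendsto F l (𝓝 G) := by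
  have hcont : Continuous g :=
    h.continuous (Eventually.of_forall fun i => (F i).continuous).frequently
  have hzero : Tendsto g (cocompact X) (𝓝 0) := by
    refine Metric.tendsto_nhds.2 fun ε hε => ?_
    obtain ⟨i, hi⟩ := (Metric.tendstoUniformly_iff.1 h (ε / 2) (half_pos hε)).exists
    filter_upwards [Metric.tendsto_nhds.1 (zero_at_infty (F i)) (ε / 2) (half_pos hε)] with x hx
    calc dist (g x) 0 ≤ dist (g x) (F i x) + dist (F i x) 0 := dist_triangle _ _ _
      _ < ε / 2 + ε / 2 := add_lt_add (hi x) hx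
      _ = ε := add_halves ε
  exact ⟨⟨⟨g, hcont⟩, hzero⟩, rfl,
    ZeroAtInftyContinuousMap.tendsto_iff_tendstoUniformly.2 h⟩

theorem exists_mem_domain_infinitesimalGenerator {Y : Type*} [NormedAddCommGroup Y]
    [NormedSpace ℝ Y] {T : ℝ≥0 → Y →L[ℝ] Y} {f g : Y}
    (h : Tendsto (fun h : ℝ≥0 => (h : ℝ)⁻¹ • (T h f - f)) (𝓝[>] 0) (𝓝 g)) :
    ∃ hf : f ∈ (infinitesimalGenerator T).domain, infinitesimalGenerator T ⟨f, hf⟩ = g :=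
  ⟨⟨g, h⟩, tendsto_nhds_unique (Exists.choose_spec (⟨g, h⟩ : ∃ g, Tendsto
    (fun h : ℝ≥0 => (h : ℝ)⁻¹ • (T h f - f)) (𝓝[>] 0) (𝓝 g))) h⟩

section

variable {E : Type*} [MeasurableSpace E] {d : ℕ} {m : Measure E} {ξ : E → Rd d} {w : E → ℂ}
  {A : Matrix (Fin d) (Fin d) ℝ} {b : Rd d} {ν : Measure (Rd d)}
  {p : ℝ≥0 → ProbabilityMeasure (Rd d)}

theorem HasGeneratingTriplet.norm_exp_mul_levyExponent_le (h : HasGeneratingTriplet p A b ν)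
    (t : ℝ≥0) (ξ : Rd d) : ‖Complex.exp (((t : ℝ) : ℂ) * levyExponent A b ν ξ)‖ ≤ 1 := by
  rw [← h.2]
  exact norm_charFun_le_one ξ

theorem ofReal_integral_translate_eq_charIntegral [SFinite m] (hp : HasGeneratingTriplet p A b ν)
    (hξ : Measurable ξ) (hw : Integrable w m) {f : Rd d → ℝ}
    (hf : ∀ x, (f x : ℂ) = charIntegral m ξ w x) (t : ℝ≥0) (x : Rd d) :
    ((∫ z, f (z + x) ∂(p t : Measure (Rd d)) : ℝ) : ℂ) = charIntegral m ξ
      (fun e => w e * Complex.exp (((t : ℝ) : ℂ) * levyExponent A b ν (ξ e))) x := by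
  rw [← integral_complex_ofReal]
  simp_rw [hf, ← hp.2]
  exact integral_charIntegral_add hξ hw _ x

/-- The `L¹`-convergence of weights behind the norm convergence of the difference quotients of
the semigroup: `(exp (tψ) - 1) / t → ψ` pointwise, with `|exp (tψ) - 1| / t ≤ |ψ|`. -/
theorem tendsto_integral_norm_mul_slope_sub (hp : HasGeneratingTriplet p A b ν)
    (h : HasSecondMoment m ξ w) :
    Tendsto (fun t : ℝ≥0 => ∫ e, ‖w e * (((t : ℝ) : ℂ)⁻¹
        * (Complex.exp (((t : ℝ) : ℂ) * levyExponent A b ν (ξ e)) - 1)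
        - levyExponent A b ν (ξ e))‖ ∂m) (𝓝[>] 0) (𝓝 0) := by
  have hψ : Measurable fun e => levyExponent A b ν (ξ e) :=
    hp.1.measurable_levyExponent.comp h.measurable_freq
  have hnhds : Tendsto (fun t : ℝ≥0 => (t : ℝ)) (𝓝[>] 0) (𝓝[≠] 0) := by
    refine tendsto_nhdsWithin_iff.2 ⟨?_, ?_⟩
    · exact (NNReal.continuous_coe.tendsto 0).mono_left nhdsWithin_le_nhds
    · filter_upwards [self_mem_nhdsWithin] with t ht
      exact (NNReal.coe_pos.2 ht).ne'
  rw [← integral_zero E ℝ (μ := m)]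
  refine tendsto_integral_filter_of_dominated_convergence
    (fun e => 2 * ‖w e * levyExponent A b ν (ξ e)‖) (Eventually.of_forall fun t => ?_) ?_
    ((h.integrable_mul_levyExponent hp.1).norm.const_mul 2) (Eventually.of_forall fun e => ?_)
  · refine (h.aestronglyMeasurable.mul (Measurable.aestronglyMeasurable ?_)).norm
    fun_prop
  · filter_upwards [self_mem_nhdsWithin] with t ht
    refine Eventually.of_forall fun e => ?_
    have ht' : (0 : ℝ) < t := ht
    have hslope : ‖((t : ℝ) : ℂ)⁻¹
        * (Complex.exp (((t : ℝ) : ℂ) * levyExponent A b ν (ξ e)) - 1)‖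
        ≤ ‖levyExponent A b ν (ξ e)‖ := by
      rw [norm_mul, norm_inv, Complex.norm_real, Real.norm_of_nonneg ht'.le,
        inv_mul_le_iff₀ ht']
      refine (Complex.norm_exp_sub_one_le_of_re_nonpos ?_).trans_eq ?_
      · rw [Complex.re_ofReal_mul]
        exact mul_nonpos_of_nonneg_of_nonpos ht'.le (hp.re_levyExponent_nonpos _)
      · rw [norm_mul, Complex.norm_real, Real.norm_of_nonneg ht'.le]
    rw [norm_norm, norm_mul, norm_mul, mul_left_comm]
    gcongr
    linarith [norm_sub_le (((t : ℝ) : ℂ)⁻¹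
      * (Complex.exp (((t : ℝ) : ℂ) * levyExponent A b ν (ξ e)) - 1)) (levyExponent A b ν (ξ e))]
  · have hd : HasDerivAt (fun r : ℝ => Complex.exp (r * levyExponent A b ν (ξ e)))
        (levyExponent A b ν (ξ e)) 0 := by
      have h1 : HasDerivAt (fun r : ℝ => (r : ℂ) * levyExponent A b ν (ξ e))
          (1 * levyExponent A b ν (ξ e)) 0 :=
        (Complex.ofRealCLM.hasDerivAt (x := 0)).mul_const _
      simpa using h1.cexp
    have hlim := ((hasDerivAt_iff_tendsto_slope_zero.1 hd).comp hnhds)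
    have hlim' := ((hlim.sub_const (levyExponent A b ν (ξ e))).const_mul (w e)).norm
    simp only [sub_self, mul_zero, norm_zero] at hlim'
    refine hlim'.congr fun t => ?_
    simp [Complex.real_smul]

/-- A function in `C₀` that is a superposition of characters with finite second moment lies in the
domain of the generator, and the generator acts on it as the Lévy operator. -/
theorem exists_levyGenerator_eq_levyOperator [SFinite m] (hp : HasGeneratingTriplet p A b ν)
    (h : HasSecondMoment m ξ w) (f : C₀(Rd d, ℝ)) (hf : ContDiff ℝ 2 f)
    (hfw : ∀ x, (f x : ℂ) = charIntegral m ξ w x) :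
    ∃ hdom : f ∈ (levyGenerator p).domain, ∀ x, levyGenerator p ⟨f, hdom⟩ x
      = levyOperator A b ν f x := by
  have hξ := h.measurable_freq
  have hψ : Measurable fun e => levyExponent A b ν (ξ e) :=
    hp.1.measurable_levyExponent.comp hξ
  have hbound : ∀ (t : ℝ≥0) (x : Rd d),
      ‖levyOperator A b ν f x - ((t : ℝ)⁻¹ • (transitionSemigroup p t f - f)) x‖
        ≤ ∫ e, ‖w e * (((t : ℝ) : ℂ)⁻¹
          * (Complex.exp (((t : ℝ) : ℂ) * levyExponent A b ν (ξ e)) - 1)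
          - levyExponent A b ν (ξ e))‖ ∂m := fun t x => by
    have hexp : Integrable (fun e => w e
        * Complex.exp (((t : ℝ) : ℂ) * levyExponent A b ν (ξ e))) m :=
      h.integrable_mul (by fun_prop : Measurable _).aestronglyMeasurable 1 fun e =>
        (hp.norm_exp_mul_levyExponent_le t (ξ e)).trans (by linarith [sq_nonneg ‖ξ e‖])
    have hi1 := integrable_mul_character hξ hexp x
    have hi2 := integrable_mul_character hξ h.integrable x
    have hi3 := integrable_mul_character hξ (h.integrable_mul_levyExponent hp.1) x
    have hi12 : Integrable (fun e => ((t : ℝ) : ℂ)⁻¹ * (w e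
        * Complex.exp (((t : ℝ) : ℂ) * levyExponent A b ν (ξ e))
          * Complex.exp ((inner ℝ x (ξ e) : ℝ) * Complex.I)
        - w e * Complex.exp ((inner ℝ x (ξ e) : ℝ) * Complex.I))) m := (hi1.sub hi2).const_mul _
    have heq : (((t : ℝ)⁻¹ • (transitionSemigroup p t f - f)) x : ℂ)
        - (levyOperator A b ν f x : ℂ) = charIntegral m ξ (fun e => w e * (((t : ℝ) : ℂ)⁻¹
          * (Complex.exp (((t : ℝ) : ℂ) * levyExponent A b ν (ξ e)) - 1)
          - levyExponent A b ν (ξ e))) x := by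
      have hT := ofReal_integral_translate_eq_charIntegral hp hξ h.integrable hfw t x
      rw [← transitionSemigroup_apply] at hT
      rw [ZeroAtInftyContinuousMap.smul_apply, ZeroAtInftyContinuousMap.sub_apply, smul_eq_mul,
        Complex.ofReal_mul, Complex.ofReal_sub, hT, hfw,
        ofReal_levyOperator_eq_charIntegral h hp.1 hf hfw, Complex.ofReal_inv]
      simp only [charIntegral]
      rw [← integral_sub hi1 hi2, ← integral_const_mul, ← integral_sub hi12 hi3]
      congr 1 with e
      ring
    rw [norm_sub_rev, ← Complex.norm_real, Complex.ofReal_sub, heq]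
    exact norm_charIntegral_le x
  have hunif : TendstoUniformly (fun (t : ℝ≥0) => ⇑((t : ℝ)⁻¹ • (transitionSemigroup p t f - f)))
      (levyOperator A b ν f) (𝓝[>] 0) := by
    refine Metric.tendstoUniformly_iff.2 fun ε hε => ?_
    filter_upwards [(tendsto_integral_norm_mul_slope_sub hp h).eventually_lt_const hε] with t ht x
    rw [dist_eq_norm]
    exact (hbound t x).trans_lt ht
  obtain ⟨G, hG, hlim⟩ :=
    ZeroAtInftyContinuousMap.exists_tendsto_of_tendstoUniformly hunif
  obtain ⟨hdom, heq⟩ := exists_mem_domain_infinitesimalGenerator hlim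
  exact ⟨hdom, fun x => (congrArg (· x) heq).trans (congrFun hG x)⟩

end

/-! ### Space-time Fourier inversion -/

/-- A smooth compactly supported function on `ℝ × ℝ^d` is a superposition of the space-time
characters `exp (i(τu + ⟨x, ξ⟩))` with a rapidly decreasing weight: the Fourier transform of the
function on the Euclidean space underlying `ℝ × ℝ^d`. -/
theorem exists_charIntegral_eq {d : ℕ} {φ : ℝ × Rd d → ℝ} (hφ : ContDiff ℝ ∞ φ)
    (hc : HasCompactSupport φ) :
    ∃ (w : WithLp 2 (ℝ × Rd d) → ℂ) (ξ : WithLp 2 (ℝ × Rd d) → Rd d)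
      (τ : WithLp 2 (ℝ × Rd d) → ℝ), HasSecondMoment volume ξ w ∧ Measurable τ ∧
        Integrable (fun e => w e * (τ e * Complex.I)) volume ∧
        ∀ u x, (φ (u, x) : ℂ)
          = charIntegral volume ξ (fun e => w e * Complex.exp (u * (τ e * Complex.I))) x := by
  set ι := WithLp.prodContinuousLinearEquiv 2 ℝ ℝ (Rd d)
  have hc' : HasCompactSupport fun e : WithLp 2 (ℝ × Rd d) => (φ (ι e) : ℂ) :=
    (hc.comp_homeomorph ι.toHomeomorph).comp_left (g := fun r : ℝ => (r : ℂ)) Complex.ofReal_zero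
  have hφ' : ContDiff ℝ ∞ fun e : WithLp 2 (ℝ × Rd d) => (φ (ι e) : ℂ) :=
    Complex.ofRealCLM.contDiff.comp (hφ.comp ι.contDiff)
  set S := hc'.toSchwartzMap hφ'
  set g := FourierTransform.fourier S
  have hfst : ∀ e : WithLp 2 (ℝ × Rd d), ‖e.fst‖ ≤ ‖e‖ := fun e => WithLp.norm_fst_le _ e
  have hsnd : ∀ e : WithLp 2 (ℝ × Rd d), ‖e.snd‖ ≤ ‖e‖ := fun e => WithLp.norm_snd_le _ e
  have hmξ : Measurable fun e : WithLp 2 (ℝ × Rd d) => (2 * Real.pi) • e.snd :=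
    ((ι.continuous.snd).const_smul (2 * Real.pi)).measurable
  have hmτ : Measurable fun e : WithLp 2 (ℝ × Rd d) => 2 * Real.pi * e.fst :=
    ((ι.continuous.fst).const_mul (2 * Real.pi)).measurable
  have hg : Continuous g := g.continuous
  have h0 : Integrable (fun e => ‖g e‖) := by simpa using g.integrable_pow_mul volume 0
  have h1 : Integrable (fun e => ‖e‖ * ‖g e‖) := by simpa using g.integrable_pow_mul volume 1
  have h2 := g.integrable_pow_mul volume 2
  refine ⟨g, fun e => (2 * Real.pi) • e.snd, fun e => 2 * Real.pi * e.fst,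
    ⟨hmξ, hg.aestronglyMeasurable, ?_⟩, hmτ, ?_, fun u x => ?_⟩
  · refine (h0.add (h2.const_mul ((2 * Real.pi) ^ 2))).mono' ?_ (Eventually.of_forall fun e => ?_)
    · exact ((hmξ.norm.pow_const 2).const_add 1).aestronglyMeasurable.mul
        hg.norm.aestronglyMeasurable
    · rw [Real.norm_of_nonneg (by positivity), Pi.add_apply, norm_smul,
        Real.norm_of_nonneg (by positivity : (0 : ℝ) ≤ 2 * Real.pi), mul_pow, add_mul, one_mul,
        mul_assoc]
      gcongr
      exact hsnd e
  · refine (h1.const_mul (2 * Real.pi)).mono' ?_ (Eventually.of_forall fun e => ?_)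
    · exact hg.aestronglyMeasurable.mul
        (by fun_prop : Measurable fun e : WithLp 2 (ℝ × Rd d) =>
          ((2 * Real.pi * e.fst : ℝ) : ℂ) * Complex.I).aestronglyMeasurable
    · rw [norm_mul, norm_mul, Complex.norm_I, mul_one, Complex.norm_real, norm_mul,
        Real.norm_of_nonneg (by positivity : (0 : ℝ) ≤ 2 * Real.pi), mul_comm, mul_assoc]
      gcongr
      exact hfst e
  · have hinv : (FourierTransformInv.fourierInv g) (WithLp.toLp 2 (u, x)) = (φ (u, x) : ℂ) := by
      rw [show FourierTransformInv.fourierInv g = S from FourierPair.fourierInv_fourier_eq S]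
      rfl
    rw [← hinv, SchwartzMap.fourierInv_coe, Real.fourierInv_eq']
    simp only [charIntegral]
    congr 1 with e
    rw [smul_eq_mul, mul_comm, mul_assoc (g e), ← Complex.exp_add]
    congr 2
    simp only [WithLp.prod_inner_apply, inner_smul_right]
    simp [real_inner_comm]
    ring

/-! ### The space-time identity -/

/-- The fundamental theorem of calculus on `(s, ∞)` for `u ↦ ∫ W e * exp ((u - s) * z e)` with
`Re z ≤ 0`, when this function vanishes for large `u`. -/
theorem integral_Ioi_integral_mul_exp {E : Type*} [MeasurableSpace E] {m : Measure E}
    {W z : E → ℂ} (hz : AEStronglyMeasurable z m) (hre : ∀ e, (z e).re ≤ 0) (hW : Integrable W m)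
    (hWz : Integrable (fun e => W e * z e) m) {s T : ℝ} (hsT : s ≤ T)
    (hzero : ∀ u > T, ∫ e, W e * Complex.exp ((u - s : ℝ) * z e) ∂m = 0) :
    IntegrableOn (fun u : ℝ => ∫ e, W e * z e * Complex.exp ((u - s : ℝ) * z e) ∂m) (Ioi s) ∧
      ∫ u in Ioi s, ∫ e, W e * z e * Complex.exp ((u - s : ℝ) * z e) ∂m = -∫ e, W e ∂m := by
  have hexp : ∀ r : ℝ, AEStronglyMeasurable (fun e => Complex.exp (r * z e)) m := fun r =>
    Complex.continuous_exp.comp_aestronglyMeasurable (hz.const_mul _)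
  have hle : ∀ r : ℝ, 0 ≤ r → ∀ e, ‖Complex.exp (r * z e)‖ ≤ 1 := fun r hr e => by
    rw [Complex.norm_exp, Complex.re_ofReal_mul]
    exact Real.exp_le_one_iff.2 (mul_nonpos_of_nonneg_of_nonpos hr (hre e))
  have hderiv : ∀ u ∈ Ioi s, HasDerivAt
      (fun u : ℝ => ∫ e, W e * Complex.exp ((u - s : ℝ) * z e) ∂m)
      (∫ e, W e * z e * Complex.exp ((u - s : ℝ) * z e) ∂m) u := fun u hu =>
    (hasDerivAt_integral_mul_exp hz hW hWz (Ioi_mem_nhds (sub_pos.2 hu)) fun r hr e =>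
      mul_nonpos_of_nonneg_of_nonpos (le_of_lt hr) (hre e)).comp_sub_const u s
  have hcont : ContinuousWithinAt
      (fun u : ℝ => ∫ e, W e * Complex.exp ((u - s : ℝ) * z e) ∂m) (Ici s) s := by
    refine continuousWithinAt_of_dominated (bound := fun e => ‖W e‖)
      (Eventually.of_forall fun u => hW.aestronglyMeasurable.mul (hexp _)) ?_ hW.norm
      (Eventually.of_forall fun e => by fun_prop)
    filter_upwards [self_mem_nhdsWithin] with u hu
    refine Eventually.of_forall fun e => ?_
    rw [norm_mul]
    exact mul_le_of_le_one_right (norm_nonneg _) (hle _ (sub_nonneg.2 hu) e)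
  have hbdd : ∀ u ∈ Ioi s, ‖∫ e, W e * z e * Complex.exp ((u - s : ℝ) * z e) ∂m‖
      ≤ ∫ e, ‖W e * z e‖ ∂m := fun u hu => by
    refine norm_integral_le_of_norm_le hWz.norm (Eventually.of_forall fun e => ?_)
    rw [norm_mul]
    exact mul_le_of_le_one_right (norm_nonneg _) (hle _ (sub_pos.2 hu).le e)
  have hmeas : AEStronglyMeasurable
      (fun u : ℝ => ∫ e, W e * z e * Complex.exp ((u - s : ℝ) * z e) ∂m)
      (volume.restrict (Ioi s)) :=
    (aestronglyMeasurable_deriv _ _).congr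
      ((ae_restrict_mem measurableSet_Ioi).mono fun u hu => (hderiv u hu).deriv)
  -- Beyond `T` the derivative of the vanishing function is zero, so the integrand has bounded
  -- support.
  have hzero' : ∀ u ∈ Ioi T, ∫ e, W e * z e * Complex.exp ((u - s : ℝ) * z e) ∂m = 0 :=
    fun u hu => (hderiv u (hsT.trans_lt hu)).unique
      ((hasDerivAt_const u (0 : ℂ)).congr_of_eventuallyEq
        (eventually_of_mem (Ioi_mem_nhds hu) hzero))
  have hint : IntegrableOn
      (fun u : ℝ => ∫ e, W e * z e * Complex.exp ((u - s : ℝ) * z e) ∂m) (Ioi s) := by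
    rw [← Ioc_union_Ioi_eq_Ioi hsT]
    refine IntegrableOn.union ?_ (integrableOn_zero.congr_fun
      (fun u hu => (hzero' u hu).symm) measurableSet_Ioi)
    refine Integrable.of_bound (hmeas.mono_set Ioc_subset_Ioi_self) (∫ e, ‖W e * z e‖ ∂m) ?_
    exact (ae_restrict_mem measurableSet_Ioc).mono fun u hu => hbdd u hu.1
  refine ⟨hint, ?_⟩
  have hlim : Tendsto (fun u : ℝ => ∫ e, W e * Complex.exp ((u - s : ℝ) * z e) ∂m) atTop (𝓝 0) :=
    tendsto_const_nhds.congr' ((eventually_gt_atTop T).mono fun u hu => (hzero u hu).symm)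
  rw [integral_Ioi_of_hasDerivAt_of_tendsto hcont hderiv hint hlim]
  simp

theorem mainTheorem9 {d : ℕ} (p : ℝ≥0 → ProbabilityMeasure (Rd d))
    (A : Matrix (Fin d) (Fin d) ℝ) (b : Rd d) (ν : Measure (Rd d))
    (hp : IsConvolutionSemigroup p) (htriplet : HasGeneratingTriplet p A b ν)
    (φ : ℝ × Rd d → ℝ) (hφ : ContDiff ℝ ∞ φ) (hc : HasCompactSupport φ) :
    ∃ hdom : ∀ u : ℝ, timeSlice φ hφ.continuous hc u ∈ (levyGenerator p).domain,
      (∀ (u : ℝ) (x : Rd d),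
        levyGenerator p ⟨timeSlice φ hφ.continuous hc u, hdom u⟩ x
          = levyOperator A b ν (fun y => φ (u, y)) x) ∧
      ∀ (s : ℝ) (x : Rd d),
        (∀ u > s, Integrable
          (fun z => deriv (fun v => φ (v, x + z)) u
            + levyGenerator p ⟨timeSlice φ hφ.continuous hc u, hdom u⟩ (x + z))
          (p (u - s).toNNReal : Measure (Rd d))) ∧
        IntegrableOn
          (fun u => ∫ z, (deriv (fun v => φ (v, x + z)) u
            + levyGenerator p ⟨timeSlice φ hφ.continuous hc u, hdom u⟩ (x + z))
              ∂(p (u - s).toNNReal : Measure (Rd d)))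
          (Ioi s) ∧
        ∫ u in Ioi s, ∫ z, (deriv (fun v => φ (v, x + z)) u
            + levyGenerator p ⟨timeSlice φ hφ.continuous hc u, hdom u⟩ (x + z))
              ∂(p (u - s).toNNReal : Measure (Rd d))
          = -φ (s, x) := by
  obtain ⟨w, ξ, τ, hw, hτ, hwτ, hrep⟩ := exists_charIntegral_eq hφ hc
  have hξ := hw.measurable_freq
  set ψ := levyExponent A b ν
  have hψ : Measurable fun e => ψ (ξ e) := htriplet.1.measurable_levyExponent.comp hξ
  have hre : ∀ e, (τ e * Complex.I + ψ (ξ e)).re ≤ 0 := fun e => by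
    simpa using htriplet.re_levyExponent_nonpos (ξ e)
  have hnorm : ∀ (u : ℝ) e, ‖Complex.exp (u * (τ e * Complex.I))‖ = 1 := fun u e => by
    rw [← mul_assoc, ← Complex.ofReal_mul, Complex.norm_exp_ofReal_mul_I]
  have hmexp : ∀ u : ℝ, Measurable fun e => Complex.exp (u * (τ e * Complex.I)) := fun u => by
    fun_prop
  have hslice : ∀ u : ℝ, HasSecondMoment volume ξ
      (fun e => w e * Complex.exp (u * (τ e * Complex.I))) := fun u =>
    hw.mul_of_norm_eq_one (hmexp u).aestronglyMeasurable (hnorm u)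
  have hsmooth : ∀ u : ℝ, ContDiff ℝ 2 fun x : Rd d => φ (u, x) := fun u =>
    contDiff_infty.1 (hφ.comp (contDiff_const.prodMk contDiff_id)) 2
  have hgen := fun u : ℝ => exists_levyGenerator_eq_levyOperator htriplet (hslice u)
    (timeSlice φ hφ.continuous hc u) (hsmooth u) (hrep u)
  choose hdom hL using hgen
  refine ⟨hdom, hL, fun s x => ?_⟩
  -- `z` is the symbol of `∂ᵤ + L`.
  set z : WithLp 2 (ℝ × Rd d) → ℂ := fun e => τ e * Complex.I + ψ (ξ e) with hz
  have hzm : Measurable z := (by fun_prop : Measurable fun e => (τ e : ℂ) * Complex.I).add hψ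
  have hwz : Integrable (fun e => w e * z e) := by
    refine (hwτ.add (hw.integrable_mul_levyExponent htriplet.1)).congr
      (Eventually.of_forall fun e => ?_)
    simp only [hz, mul_add, Pi.add_apply, ψ]
  -- `W` carries the characters at `(s, x)`, so that `∫ W = φ (s, x)`.
  set W : WithLp 2 (ℝ × Rd d) → ℂ := fun e => w e * Complex.exp (s * (τ e * Complex.I))
    * Complex.exp ((inner ℝ x (ξ e) : ℝ) * Complex.I) with hW
  have hunimod : ∀ u : ℝ, ∀ {k : WithLp 2 (ℝ × Rd d) → ℂ}, Integrable k →
      Integrable fun e => k e * Complex.exp (u * (τ e * Complex.I)) := fun u k hk => by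
    refine hk.norm.mono' (hk.aestronglyMeasurable.mul (hmexp u).aestronglyMeasurable)
      (Eventually.of_forall fun e => ?_)
    rw [norm_mul, hnorm, mul_one]
  have hWi : Integrable W := integrable_mul_character hξ (hslice s).integrable x
  have hWz : Integrable fun e => W e * z e :=
    (integrable_mul_character hξ (hunimod s hwz) x).congr (Eventually.of_forall fun e => by
      simp only [hW]; ring)
  -- `∂ᵤφ + Lφ` is the superposition of space-time characters with weight `w * z`.
  have hspacetime : ∀ (u : ℝ) (y : Rd d), ((deriv (fun v => φ (v, y)) u
      + levyGenerator p ⟨timeSlice φ hφ.continuous hc u, hdom u⟩ y : ℝ) : ℂ)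
      = charIntegral volume ξ
        (fun e => w e * z e * Complex.exp (u * (τ e * Complex.I))) y := fun u y => by
    have hdiff : DifferentiableAt ℝ (fun v => φ (v, y)) u :=
      ((hφ.differentiable (by simp)).comp
        (differentiable_id.prodMk (differentiable_const y))).differentiableAt
    have hτI : Measurable fun e => (τ e : ℂ) * Complex.I := by fun_prop
    have hwτy := integrable_mul_character hξ hwτ y
    have hd := hasDerivAt_integral_mul_exp (m := volume)
      (W := fun e => w e * Complex.exp ((inner ℝ y (ξ e) : ℝ) * Complex.I))
      (z := fun e => τ e * Complex.I) (t := u) hτI.aestronglyMeasurable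
      (integrable_mul_character hξ hw.integrable y)
      (hwτy.congr (Eventually.of_forall fun e => by ring)) univ_mem (fun r _ e => by simp)
    have hd' : HasDerivAt (fun v => (φ (v, y) : ℂ)) _ u :=
      hd.congr_of_eventuallyEq (Eventually.of_forall fun v => by
        simp only [hrep, charIntegral]
        congr 1 with e
        ring)
    have hLy : (levyGenerator p ⟨timeSlice φ hφ.continuous hc u, hdom u⟩ y : ℂ)
        = charIntegral volume ξ
          (fun e => w e * Complex.exp (u * (τ e * Complex.I)) * ψ (ξ e)) y := by
      rw [hL]
      exact ofReal_levyOperator_eq_charIntegral (hslice u) htriplet.1 (hsmooth u) (hrep u) y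
    rw [Complex.ofReal_add, hdiff.hasDerivAt.ofReal_comp.unique hd', hLy]
    simp only [charIntegral]
    rw [← integral_add]
    · congr 1 with e
      simp only [hz]
      ring
    · exact (hunimod u hwτy).congr (Eventually.of_forall fun e => by ring)
    · exact integrable_mul_character hξ ((hslice u).integrable_mul_levyExponent htriplet.1) y
  have hsplit : ∀ (u : ℝ) e, Complex.exp ((u - s : ℝ) * z e) = Complex.exp (u * (τ e * Complex.I))
      / Complex.exp (s * (τ e * Complex.I)) * Complex.exp ((u - s : ℝ) * ψ (ξ e)) := fun u e => by
    rw [← Complex.exp_sub, ← Complex.exp_add]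
    congr 1
    simp only [hz, Complex.ofReal_sub]
    ring
  -- Averaging over `p_{u-s}` multiplies the weight by `exp ((u - s) ψ)`.
  have hinner : ∀ u > s, ((∫ y, (deriv (fun v => φ (v, x + y)) u
      + levyGenerator p ⟨timeSlice φ hφ.continuous hc u, hdom u⟩ (x + y))
        ∂(p (u - s).toNNReal : Measure (Rd d)) : ℝ) : ℂ)
      = ∫ e, W e * z e * Complex.exp ((u - s : ℝ) * z e) := fun u hu => by
    simp_rw [add_comm x]
    rw [ofReal_integral_translate_eq_charIntegral (f := fun y => deriv (fun v => φ (v, y)) u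
        + levyGenerator p ⟨timeSlice φ hφ.continuous hc u, hdom u⟩ y) htriplet hξ
        (hunimod u hwz) (hspacetime u),
      Real.coe_toNNReal _ (sub_pos.2 hu).le]
    simp only [charIntegral]
    congr 1 with e
    rw [hsplit]
    simp only [hW, ψ]
    field_simp [Complex.exp_ne_zero]
  have hF : ∀ u > s, ((∫ y, φ (u, y + x) ∂(p (u - s).toNNReal : Measure (Rd d)) : ℝ) : ℂ)
      = ∫ e, W e * Complex.exp ((u - s : ℝ) * z e) := fun u hu => by
    rw [ofReal_integral_translate_eq_charIntegral (f := fun y => φ (u, y)) htriplet hξ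
      (hslice u).integrable (hrep u), Real.coe_toNNReal _ (sub_pos.2 hu).le]
    simp only [charIntegral]
    congr 1 with e
    rw [hsplit]
    simp only [hW, ψ]
    field_simp [Complex.exp_ne_zero]
  obtain ⟨T, hT⟩ := (hc.isCompact.image continuous_fst).bddAbove
  have hvanish : ∀ u > max s T, ∫ e, W e * Complex.exp ((u - s : ℝ) * z e) = 0 := fun u hu => by
    have hφ0 : ∀ y, φ (u, y) = 0 := fun y => image_eq_zero_of_notMem_tsupport fun hmem =>
      (lt_of_le_of_lt (hT (mem_image_of_mem Prod.fst hmem)) ((le_max_right s T).trans_lt hu)).false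
    rw [← hF u ((le_max_left s T).trans_lt hu)]
    simp [hφ0]
  obtain ⟨hint, hval⟩ := integral_Ioi_integral_mul_exp hzm.aestronglyMeasurable hre hWi hWz
    (le_max_left s T) hvanish
  have hWval : ∫ e, W e = (φ (s, x) : ℂ) := (hrep s x).symm
  refine ⟨fun u _ => ?_, ?_, ?_⟩
  · have hcont : Continuous fun y : Rd d => deriv (fun v => φ (v, y)) u
        + levyGenerator p ⟨timeSlice φ hφ.continuous hc u, hdom u⟩ y := by
      refine (Complex.continuous_re.comp (continuous_charIntegral hξ (hunimod u hwz))).congr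
        fun y => ?_
      rw [Function.comp_apply, ← hspacetime u y]
      exact Complex.ofReal_re _
    refine Integrable.of_bound (hcont.comp (continuous_const_add x)).aestronglyMeasurable
      (∫ e, ‖w e * z e * Complex.exp (u * (τ e * Complex.I))‖)
      (Eventually.of_forall fun y => ?_)
    rw [← Complex.norm_real]
    exact (congrArg norm (hspacetime u (x + y))).trans_le (norm_charIntegral_le _)
  · refine hint.re.congr ?_
    filter_upwards [ae_restrict_mem measurableSet_Ioi] with u hu
    rw [← hinner u hu]
    exact Complex.ofReal_re _
  · refine Complex.ofReal_injective ?_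
    rw [← integral_complex_ofReal, setIntegral_congr_fun measurableSet_Ioi hinner, hval, hWval,
      Complex.ofReal_neg]
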